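/- Let $m$ be Lebesgue measure on $[0,1]$, let $S:[0,1]\to[0,1]$ be an automorphism of $([0,1],m)$ (an invertible, bimeasurable, $m$-preserving transformation), and let $r:[0,1]\to[0,\infty)$ be a measurable, $m$-integrable function. Let $X=\{(a,b): a\in[0,1],\ 0\le b<r(a)\}$ be the region under the graph of $r$, with the normalized area measure $\mu$, and let $(T_t)_{t\in\mathbb R}$ be the special flow over $S$ with roof function $r$: each point of $X$ moves vertically upward with unit speed, $T_t(a,b)=(a,b+t)$, the points $(a,r(a))$ and $(S(a),0)$ being identified. (The flow is determined for all times on almost every point; on the exceptional null set of vertical lines that cannot be followed for all times it is taken to be the identity.) Assume that the flow $T_t$ is ergodic with respect to $\mu$. Let $f\in L_1(X,\mu)$ satisfy $\int_X f\,d\mu=0$, and let $A\subset X$ be a $\mu$-measurable set. Then for $\mu$-almost every $x\in A$ with $f(x)\neq 0$ there is a sequence $t_k\to+\infty$ such that, for every $k$, the function $s\mapsto f(T_sx)$ is integrable on $[0,t_k]$ and $$\Phi(t_k,x):=\int_0^{t_k} f(T_sx)\,ds=0,\qquad T_{t_k}x\in A.$$ -/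

import Mathlib

open MeasureTheory Filter Set
open scoped unitInterval

namespace SpecialFlow

/-- The roof cocycle: `∑ i < n, r (S^i a)` for `n ≥ 0` and `-∑ 1 ≤ i ≤ -n, r (S^(-i) a)` for
`n < 0`. It is the (signed) time at which the vertical line started at `(a, 0)` arrives at the
base point `S^n a`. -/
def roofSum (S : I ≃ᵐ I) (r : I → ℝ) (a : I) : ℤ → ℝ
  | Int.ofNat n => ∑ i ∈ Finset.range n, r ((S.toEquiv ^ (i : ℤ) : Equiv.Perm I) a)
  | Int.negSucc n =>
      -∑ i ∈ Finset.range (n + 1), r ((S.toEquiv ^ (-((i : ℤ) + 1)) : Equiv.Perm I) a)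

theorem roofSum_add_one (S : I ≃ᵐ I) (r : I → ℝ) (a : I) (n : ℤ) :
    roofSum S r a (n + 1) = roofSum S r a n + r ((S.toEquiv ^ n : Equiv.Perm I) a) := by
  rcases n with n | n
  · have h : Int.ofNat n + 1 = Int.ofNat (n + 1) := by simp
    rw [h]
    simp only [roofSum, Finset.sum_range_succ]
    rfl
  · rcases n with _ | n
    · have h : Int.negSucc 0 + 1 = Int.ofNat 0 := by decide
      rw [h]
      simp [roofSum]
    · have h : Int.negSucc (n + 1) + 1 = Int.negSucc n := by omega
      have h2 : (-(((n + 1 : ℕ) : ℤ) + 1)) = Int.negSucc (n + 1) := by omega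
      rw [h]
      simp only [roofSum]
      rw [Finset.sum_range_succ _ (n + 1), h2]
      ring

/-- The region under the graph of the roof function `r`. The point `(a, r a)` of the upper
boundary is represented by the point `(S a, 0)` with which it is identified. -/
def phaseSpace (r : I → ℝ) : Set (I × ℝ) :=
  {p | 0 ≤ p.2 ∧ p.2 < r p.1}

/-- The normalized area measure on the phase space. -/
noncomputable def phaseMeasure (r : I → ℝ) : Measure (phaseSpace r) :=
  (volume (phaseSpace r))⁻¹ • (volume : Measure (I × ℝ)).comap Subtype.val

/-- The vertical line through the base point `a` can be followed for all positive and negative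
times. If `S` preserves Lebesgue measure and `r ≥ 0` is measurable, this holds for almost every
`a` with `r a > 0`. -/
def IsComplete (S : I ≃ᵐ I) (r : I → ℝ) (a : I) : Prop :=
  ∀ u : ℝ, ∃ n : ℤ, roofSum S r a n ≤ u ∧ u < roofSum S r a (n + 1)

open Classical in
/-- The special flow over `S` under `r`: a point moves vertically upwards with unit speed and
passes from `(a, r a)` to `(S a, 0)`, that is, `T_t (a, b) = (S^n a, b + t - roofSum n a)` where
`n` is the integer with `roofSum n a ≤ b + t < roofSum (n + 1) a`. Points on lines which
cannot be followed for all times (a null set) are kept fixed. -/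
noncomputable def flow (S : I ≃ᵐ I) (r : I → ℝ) (t : ℝ) (x : phaseSpace r) : phaseSpace r :=
  if h : IsComplete S r x.1.1 then
    ⟨((S.toEquiv ^ (h (x.1.2 + t)).choose : Equiv.Perm I) x.1.1,
        x.1.2 + t - roofSum S r x.1.1 (h (x.1.2 + t)).choose), by
      have h1 := (h (x.1.2 + t)).choose_spec
      rw [roofSum_add_one] at h1
      exact ⟨sub_nonneg.2 h1.1, by linarith [h1.2]⟩⟩
  else x

/-- Ergodicity of a flow: every invariant measurable set is null or conull. -/
def IsErgodicFlow {X : Type*} [MeasurableSpace X] (T : ℝ → X → X) (μ : Measure X) : Prop :=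
  ∀ B : Set X, MeasurableSet B → (∀ t : ℝ, T t ⁻¹' B = B) → μ B = 0 ∨ μ Bᶜ = 0

/-- `Φ(t, x) = ∫_0^t f (T_s x) ds`. -/
noncomputable def orbitIntegral {X : Type*} (T : ℝ → X → X) (f : X → ℝ) (t : ℝ) (x : X) : ℝ :=
  ∫ s in (0 : ℝ)..t, f (T s x)

end SpecialFlow

/-! # Zero returns of orbit integrals over an ergodic special flow -/

/-! By Lebesgue differentiation along orbits, almost every point of `A` with `f ≠ 0` lies in some
`escapeSet`: for short times its orbit integral `Φ` grows at least linearly. Let `B` be the part of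
an escape set that has no zero return after time `N`. Along one orbit take time windows of length
`δ` separated by gaps `N`. On the visits to `B` in one window, `Φ` is injective and expands by `δ`;
different windows give disjoint values of `Φ`, since a common value would be a late zero return.
Hence the time spent in `B` is at most `δ⁻¹` times the length of the range of `Φ`
(`sum_volume_visits_le`).

That range grows sublinearly in mean: by von Neumann's argument, coboundaries of bounded functions
approximate `f` in `L¹`, and their orbit integrals are bounded (`exists_lintegral_sub_le`).
Integrating over `μ` and comparing linear with sublinear growth gives `μ B = 0`
(`measure_eq_zero_of_forall_orbitIntegral_ne_zero`). This works for any ergodic measure-preserving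
flow on a standard Borel probability space; it remains to see that the special flow is one. -/

namespace SpecialFlow

/-! ### Measurable flows, ergodicity, and `L¹` approximation by coboundaries -/

section AbstractFlow

variable {X : Type*} [MeasurableSpace X] {T : ℝ → X → X} {μ : Measure X}

/-- A jointly measurable action of `ℝ` by measure preserving maps. -/
structure IsMeasurePreservingFlow (T : ℝ → X → X) (μ : Measure X) : Prop where
  measurable_uncurry : Measurable (Function.uncurry T)
  map_zero : ∀ x, T 0 x = x
  map_add : ∀ s t x, T (s + t) x = T t (T s x)
  measurePreserving : ∀ t, MeasurePreserving (T t) μ μ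

namespace IsMeasurePreservingFlow

theorem measurable_orbit (hT : IsMeasurePreservingFlow T μ) (x : X) :
    Measurable fun s => T s x :=
  hT.measurable_uncurry.comp (measurable_id.prodMk measurable_const)

theorem measurable_swap (hT : IsMeasurePreservingFlow T μ) :
    Measurable fun p : X × ℝ => T p.2 p.1 :=
  hT.measurable_uncurry.comp _root_.measurable_swap

/-- A property which holds almost everywhere holds at almost every time on almost every orbit. -/
theorem ae_ae_orbit [SFinite μ] (hT : IsMeasurePreservingFlow T μ) {p : X → Prop}
    (hp : ∀ᵐ x ∂μ, p x) : ∀ᵐ x ∂μ, ∀ᵐ s : ℝ, p (T s x) := by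
  obtain ⟨Z, hZp, hZm, hZ⟩ := exists_measurable_superset_of_null (ae_iff.1 hp)
  have h1 : ∀ᵐ s : ℝ, ∀ᵐ x ∂μ, T s x ∉ Z := by
    refine Eventually.of_forall fun s => ?_
    exact (hT.measurePreserving s).quasiMeasurePreserving.ae (measure_eq_zero_iff_ae_notMem.1 hZ)
  have h2 := (Measure.ae_ae_comm (p := fun (s : ℝ) x => T s x ∉ Z)
    (hT.measurable_uncurry hZm.compl)).1 h1
  filter_upwards [h2] with x hx
  filter_upwards [hx] with s hs
  by_contra h
  exact hs (hZp h)

/-- A measurable set which almost every orbit meets only at a null set of times is null. -/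
theorem measure_eq_zero_of_ae_ae_orbit [SFinite μ] (hT : IsMeasurePreservingFlow T μ) {Z : Set X}
    (hZ : MeasurableSet Z) (h : ∀ᵐ x ∂μ, ∀ᵐ s : ℝ, T s x ∉ Z) : μ Z = 0 := by
  have h2 := (Measure.ae_ae_comm (p := fun (s : ℝ) x => T s x ∉ Z)
    (hT.measurable_uncurry hZ.compl)).2 h
  obtain ⟨s, hs⟩ := h2.exists
  rw [← (hT.measurePreserving s).measure_preimage hZ.nullMeasurableSet]
  exact measure_eq_zero_iff_ae_notMem.2 hs

theorem lintegral_setLIntegral_orbit [SFinite μ] (hT : IsMeasurePreservingFlow T μ)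
    {g : X → ENNReal} (hg : Measurable g) (J : Set ℝ) :
    ∫⁻ x, (∫⁻ s in J, g (T s x)) ∂μ = volume J * ∫⁻ x, g x ∂μ := by
  rw [lintegral_lintegral_swap (f := fun x s => g (T s x))
    (hg.comp hT.measurable_swap).aemeasurable]
  simp_rw [(hT.measurePreserving _).lintegral_comp hg]
  rw [lintegral_const, Measure.restrict_apply_univ, mul_comm]

/-- `IsErgodicFlow` concerns strictly invariant sets, whereas here the exceptional null set depends
on `t`. So `φ ⁻¹' U` is replaced by the set of points whose orbit lies in it at almost every time:
strictly invariant because Lebesgue measure is translation invariant, and almost everywhere equal to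
`φ ⁻¹' U` by Fubini. -/
theorem ae_eq_const_of_ae_invariant [IsFiniteMeasure μ] (hT : IsMeasurePreservingFlow T μ)
    (herg : IsErgodicFlow T μ) {φ : X → ℝ} (hφ : Measurable φ)
    (hinv : ∀ t, φ ∘ T t =ᵐ[μ] φ) : ∃ c : ℝ, φ =ᵐ[μ] fun _ => c := by
  refine Filter.exists_eventuallyEq_const_of_forall_separating MeasurableSet fun U hU => ?_
  set B : Set X := {x | ∀ᵐ s : ℝ, φ (T s x) ∈ U} with hB
  have hBm : MeasurableSet B := by
    have h1 : MeasurableSet {p : X × ℝ | φ (T p.2 p.1) ∉ U} :=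
      (hφ.comp hT.measurable_swap) hU.compl
    exact (measurable_measure_prodMk_left (ν := (volume : Measure ℝ)) h1) (measurableSet_singleton 0)
  have hBinv : ∀ t, T t ⁻¹' B = B := by
    intro t
    ext x
    simp only [hB, mem_preimage, mem_ofPred_eq, ← hT.map_add]
    constructor
    · intro h
      have := (measurePreserving_add_left (volume : Measure ℝ) (-t)).quasiMeasurePreserving.ae h
      simpa using this
    · intro h
      exact (measurePreserving_add_left (volume : Measure ℝ) t).quasiMeasurePreserving.ae h
  have hBφ : ∀ᵐ x ∂μ, (x ∈ B ↔ φ x ∈ U) := by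
    have h1 : ∀ᵐ x ∂μ, ∀ᵐ s : ℝ, φ (T s x) = φ x := by
      refine (Measure.ae_ae_comm (p := fun (s : ℝ) x => φ (T s x) = φ x) ?_).1
        (Eventually.of_forall hinv)
      exact measurableSet_eq_fun (hφ.comp hT.measurable_uncurry) (hφ.comp measurable_snd)
    filter_upwards [h1] with x hx
    constructor
    · intro h
      obtain ⟨s, hs, hs'⟩ := (hx.and h).exists
      rwa [← hs]
    · intro h
      filter_upwards [hx] with s hs
      rwa [hs]
  rcases herg B hBm hBinv with h | h
  · right
    filter_upwards [hBφ, measure_eq_zero_iff_ae_notMem.1 h] with x h1 h2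
    exact fun h3 => h2 (h1.2 h3)
  · left
    filter_upwards [hBφ, measure_eq_zero_iff_ae_notMem.1 h] with x h1 h2
    exact h1.1 (not_not.1 h2)

end IsMeasurePreservingFlow

/-- A bounded measurable function whose integrals along orbits are uniformly bounded. -/
structure HasBoundedOrbitIntegrals (T : ℝ → X → X) (g : X → ℝ) : Prop where
  measurable : Measurable g
  bounded : ∃ M, ∀ x, |g x| ≤ M
  bounded_orbitIntegral : ∃ C, ∀ t x, |orbitIntegral T g t x| ≤ C

namespace HasBoundedOrbitIntegrals

theorem _root_.MeasureTheory.intervalIntegrable_of_measurable_of_bound {g : ℝ → ℝ}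
    (hg : Measurable g) {M : ℝ} (hM : ∀ x, |g x| ≤ M) (a b : ℝ) :
    IntervalIntegrable g volume a b :=
  (intervalIntegrable_const (c := M)).mono_fun hg.aestronglyMeasurable
    (Eventually.of_forall fun x => by
      simpa using (hM x).trans (le_abs_self M))

theorem intervalIntegrable {g : X → ℝ} (hg : HasBoundedOrbitIntegrals T g)
    (hT : IsMeasurePreservingFlow T μ) (x : X) (a b : ℝ) :
    IntervalIntegrable (fun s => g (T s x)) volume a b := by
  obtain ⟨M, hM⟩ := hg.bounded
  exact intervalIntegrable_of_measurable_of_bound (hg.measurable.comp (hT.measurable_orbit x))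
    (fun s => hM _) a b

theorem memLp [IsFiniteMeasure μ] {g : X → ℝ} (hg : HasBoundedOrbitIntegrals T g)
    (p : ENNReal) : MemLp g p μ := by
  obtain ⟨M, hM⟩ := hg.bounded
  exact MemLp.of_bound hg.measurable.aestronglyMeasurable M (Eventually.of_forall hM)

theorem zero : HasBoundedOrbitIntegrals T (fun _ : X => (0 : ℝ)) :=
  ⟨measurable_const, ⟨0, by simp⟩, ⟨0, by simp [orbitIntegral]⟩⟩

theorem add (hT : IsMeasurePreservingFlow T μ) {g h : X → ℝ} (hg : HasBoundedOrbitIntegrals T g)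
    (hh : HasBoundedOrbitIntegrals T h) : HasBoundedOrbitIntegrals T (g + h) := by
  obtain ⟨M, hM⟩ := hg.bounded
  obtain ⟨N, hN⟩ := hh.bounded
  obtain ⟨C, hC⟩ := hg.bounded_orbitIntegral
  obtain ⟨D, hD⟩ := hh.bounded_orbitIntegral
  refine ⟨hg.measurable.add hh.measurable, ⟨M + N, fun x => ?_⟩, ⟨C + D, fun t x => ?_⟩⟩
  · exact (abs_add_le _ _).trans (add_le_add (hM x) (hN x))
  · have : orbitIntegral T (g + h) t x = orbitIntegral T g t x + orbitIntegral T h t x :=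
      intervalIntegral.integral_add (hg.intervalIntegrable hT x 0 t)
        (hh.intervalIntegrable hT x 0 t)
    rw [this]
    exact (abs_add_le _ _).trans (add_le_add (hC t x) (hD t x))

theorem const_smul {g : X → ℝ} (hg : HasBoundedOrbitIntegrals T g) (c : ℝ) :
    HasBoundedOrbitIntegrals T (c • g) := by
  obtain ⟨M, hM⟩ := hg.bounded
  obtain ⟨C, hC⟩ := hg.bounded_orbitIntegral
  refine ⟨hg.measurable.const_smul c, ⟨|c| * M, fun x => ?_⟩, ⟨|c| * C, fun t x => ?_⟩⟩
  · simpa [abs_mul] using mul_le_mul_of_nonneg_left (hM x) (abs_nonneg c)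
  · have : orbitIntegral T (c • g) t x = c * orbitIntegral T g t x :=
      intervalIntegral.integral_const_mul c _
    rw [this, abs_mul]
    exact mul_le_mul_of_nonneg_left (hC t x) (abs_nonneg c)

/-- Coboundaries of bounded functions have bounded orbit integrals. -/
theorem sub_comp (hT : IsMeasurePreservingFlow T μ) {g : X → ℝ} (hg : Measurable g) {M : ℝ}
    (hM : ∀ x, |g x| ≤ M) (s : ℝ) : HasBoundedOrbitIntegrals T (fun x => g x - g (T s x)) := by
  refine ⟨hg.sub (hg.comp (hT.measurePreserving s).measurable), ⟨M + M, fun x => ?_⟩,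
    ⟨M * |s| + M * |s|, fun t x => ?_⟩⟩
  · exact (abs_sub _ _).trans (add_le_add (hM x) (hM _))
  · have hi : ∀ a b, IntervalIntegrable (fun u => g (T u x)) volume a b :=
      intervalIntegrable_of_measurable_of_bound (hg.comp (hT.measurable_orbit x)) (fun _ => hM _)
    have hi' : IntervalIntegrable (fun u => g (T (u + s) x)) volume 0 t :=
      intervalIntegrable_of_measurable_of_bound
        (hg.comp ((hT.measurable_orbit x).comp (measurable_id.add_const s))) (fun _ => hM _) _ _
    -- The two integrals run over `[0, t]` and `[s, t + s]`, so only end pieces of length `|s|`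
    -- survive.
    have h1 : orbitIntegral T (fun x => g x - g (T s x)) t x
        = (∫ u in (0 : ℝ)..s, g (T u x)) - ∫ u in t..(t + s), g (T u x) := by
      simp only [orbitIntegral, ← hT.map_add]
      rw [intervalIntegral.integral_sub (hi 0 t) hi',
        intervalIntegral.integral_comp_add_right (fun u => g (T u x)),
        intervalIntegral.integral_interval_sub_interval_comm (hi _ _) (hi _ _) (hi _ _), zero_add]
    have h2 : ∀ a b : ℝ, |∫ u in a..b, g (T u x)| ≤ M * |b - a| := fun a b =>
      intervalIntegral.norm_integral_le_of_norm_le_const (f := fun u => g (T u x))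
        fun u _ => hM (T u x)
    rw [h1]
    refine (abs_sub _ _).trans (add_le_add ?_ ?_)
    · simpa using h2 0 s
    · simpa using h2 t (t + s)

variable (μ) in
/-- The classes in `L²` of the functions with bounded orbit integrals. -/
def submodule [IsFiniteMeasure μ] (hT : IsMeasurePreservingFlow T μ) :
    Submodule ℝ (Lp ℝ 2 μ) where
  carrier := {φ | ∃ g, HasBoundedOrbitIntegrals T g ∧ φ =ᵐ[μ] g}
  zero_mem' := ⟨_, zero, Lp.coeFn_zero ℝ 2 μ⟩
  add_mem' := by
    rintro φ ψ ⟨g, hg, hφ⟩ ⟨h, hh, hψ⟩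
    exact ⟨g + h, hg.add hT hh, (Lp.coeFn_add φ ψ).trans (hφ.add hψ)⟩
  smul_mem' := by
    rintro c φ ⟨g, hg, hφ⟩
    exact ⟨c • g, hg.const_smul c, (Lp.coeFn_smul c φ).trans (hφ.const_smul c)⟩

/-- Orthogonality to the coboundary of an indicator `1_C`, with the flow moved to the other factor
by invariance of `μ`, says that `φ` and `φ ∘ T t` have the same integral over every `C`. So `φ` is
invariant, and ergodicity applies. -/
theorem ae_eq_const_of_mem_orthogonal [IsFiniteMeasure μ] (hT : IsMeasurePreservingFlow T μ)
    (herg : IsErgodicFlow T μ) {φ : Lp ℝ 2 μ} (hφ : φ ∈ (submodule μ hT)ᗮ) :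
    ∃ c : ℝ, φ =ᵐ[μ] fun _ => c := by
  have hm : Measurable φ := (Lp.stronglyMeasurable φ).measurable
  have hint : Integrable φ μ := (Lp.memLp φ).integrable one_le_two
  refine hT.ae_eq_const_of_ae_invariant herg hm fun t => ?_
  have hcomp : Integrable (φ ∘ T t) μ := (hT.measurePreserving t).integrable_comp_of_integrable hint
  refine ae_eq_of_forall_setIntegral_eq_of_sigmaFinite (fun _ _ _ => hcomp.integrableOn)
    (fun _ _ _ => hint.integrableOn) fun C hC _ => ?_
  set g : X → ℝ := C.indicator 1 with hg
  have hgm : Measurable g := measurable_one.indicator hC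
  have hgM : ∀ x, |g x| ≤ 1 := fun x => by
    by_cases h : x ∈ C <;> simp [hg, h]
  have hb := sub_comp hT hgm hgM (-t)
  have hmem : (hb.memLp 2 : MemLp _ 2 μ).toLp _ ∈ submodule μ hT :=
    ⟨_, hb, MemLp.coeFn_toLp _⟩
  have h0 := (Submodule.mem_orthogonal _ _).1 hφ _ hmem
  rw [L2.inner_def] at h0
  have h1 : ∫ x, (g x * φ x - g (T (-t) x) * φ x) ∂μ = 0 := by
    rw [← h0]
    refine integral_congr_ae ?_
    filter_upwards [MemLp.coeFn_toLp (hb.memLp 2 : MemLp _ 2 μ)] with x hx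
    rw [hx]
    simp
    ring
  have hi1 : Integrable (fun x => g x * φ x) μ :=
    hint.bdd_mul hgm.aestronglyMeasurable (Eventually.of_forall hgM)
  have hi2 : Integrable (fun x => g (T (-t) x) * φ x) μ :=
    hint.bdd_mul (hgm.comp (hT.measurePreserving (-t)).measurable).aestronglyMeasurable
      (Eventually.of_forall fun x => hgM _)
  rw [integral_sub hi1 hi2, sub_eq_zero] at h1
  have h2 : ∫ x, g (T (-t) x) * φ x ∂μ = ∫ x, g x * φ (T t x) ∂μ := by
    have h3 := integral_map (hT.measurePreserving t).measurable.aemeasurable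
      (μ := μ) (f := fun x => g (T (-t) x) * φ x)
      ((hT.measurePreserving t).map_eq.symm ▸ hi2.1)
    simpa only [(hT.measurePreserving t).map_eq, ← hT.map_add, add_neg_cancel, hT.map_zero]
      using h3
  rw [h2] at h1
  rw [← integral_indicator hC, ← integral_indicator hC]
  have e : ∀ ψ : X → ℝ, C.indicator ψ = fun x => g x * ψ x := fun ψ => by
    ext x; by_cases h : x ∈ C <;> simp [hg, h]
  rw [e, e]
  exact h1.symm

/-- Over an ergodic flow, an integrable function of mean zero is approximated in `L¹` by functions
with bounded orbit integrals. -/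
theorem exists_lintegral_sub_le [IsProbabilityMeasure μ] (hT : IsMeasurePreservingFlow T μ)
    (herg : IsErgodicFlow T μ) {f : X → ℝ} (hf : Integrable f μ) (hf0 : ∫ x, f x ∂μ = 0)
    {ε : ENNReal} (hε : ε ≠ 0) :
    ∃ g, HasBoundedOrbitIntegrals T g ∧ ∫⁻ x, ‖f x - g x‖ₑ ∂μ ≤ ε := by
  have hε3 : ε / 3 ≠ 0 := by simp [hε]
  -- The three thirds of `ε` pay for the simple function `h`, for its mean `c`, and for the `L²`
  -- approximation of `h - c`.
  obtain ⟨h, hh, -⟩ := (memLp_one_iff_integrable.2 hf).exists_simpleFunc_eLpNorm_sub_lt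
    ENNReal.one_ne_top hε3
  have hhi : Integrable h μ := h.integrable_of_isFiniteMeasure
  set c := ∫ x, h x ∂μ with hc
  have hcb : ‖c‖ₑ ≤ ε / 3 := by
    have : c = ∫ x, (h x - f x) ∂μ := by rw [integral_sub hhi hf, hf0, sub_zero]
    rw [this]
    refine (enorm_integral_le_lintegral_enorm _).trans ?_
    refine le_trans (le_of_eq ?_) hh.le
    rw [eLpNorm_one_eq_lintegral_enorm]
    simp_rw [Pi.sub_apply, ← enorm_neg (f _ - h _), neg_sub]
  have hk2 : MemLp (fun x => h x - c) 2 μ :=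
    (h.memLp_of_isFiniteMeasure 2 μ).sub (memLp_const c)
  have hmem : hk2.toLp _ ∈ (submodule μ hT).topologicalClosure := by
    -- The closure is the double orthogonal complement; the complement consists of constants, to
    -- which the mean-zero function `h - c` is orthogonal.
    rw [← Submodule.orthogonal_orthogonal_eq_closure, Submodule.mem_orthogonal]
    intro φ hφ
    obtain ⟨d, hd⟩ := ae_eq_const_of_mem_orthogonal hT herg hφ
    rw [L2.inner_def]
    have : ∫ x, (h x - c) * d ∂μ = 0 := by
      rw [integral_mul_const, integral_sub hhi (integrable_const c)]
      simp [hc]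
    rw [← this]
    refine integral_congr_ae ?_
    filter_upwards [hd, hk2.coeFn_toLp] with x h1 h2
    rw [h1, h2]
    simp
  rw [← SetLike.mem_coe, Submodule.topologicalClosure_coe, EMetric.mem_closure_iff] at hmem
  obtain ⟨ψ, ⟨g, hg, hψ⟩, hd⟩ := hmem (ε / 3) (pos_iff_ne_zero.2 hε3)
  refine ⟨g, hg, ?_⟩
  have hd' : ∫⁻ x, ‖h x - c - g x‖ₑ ∂μ ≤ ε / 3 := by
    rw [Lp.edist_def] at hd
    have h1 : eLpNorm (fun x => h x - c - g x) 2 μ ≤ ε / 3 := by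
      refine le_trans (le_of_eq (eLpNorm_congr_ae ?_)) hd.le
      filter_upwards [hψ, hk2.coeFn_toLp] with x h1 h2
      simp [h1, h2]
    rw [← eLpNorm_one_eq_lintegral_enorm]
    exact (eLpNorm_le_eLpNorm_of_exponent_le one_le_two
      (hk2.1.sub hg.measurable.aestronglyMeasurable)).trans h1
  have hpt : ∀ x, ‖f x - g x‖ₑ ≤ ‖f x - h x‖ₑ + (‖c‖ₑ + ‖h x - c - g x‖ₑ) := fun x => by
    have : f x - g x = (f x - h x) + (c + (h x - c - g x)) := by ring
    rw [this]
    exact (enorm_add_le _ _).trans (add_le_add le_rfl (enorm_add_le _ _))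
  calc ∫⁻ x, ‖f x - g x‖ₑ ∂μ
      ≤ ∫⁻ x, (‖f x - h x‖ₑ + (‖c‖ₑ + ‖h x - c - g x‖ₑ)) ∂μ := lintegral_mono hpt
    _ = ∫⁻ x, ‖f x - h x‖ₑ ∂μ + (‖c‖ₑ + ∫⁻ x, ‖h x - c - g x‖ₑ ∂μ) := by
      rw [lintegral_add_left' (f := fun x => ‖f x - h x‖ₑ) (hf.1.sub hhi.1).enorm,
        lintegral_add_left measurable_const]
      simp
    _ ≤ ε / 3 + (ε / 3 + ε / 3) := by
      refine add_le_add ?_ (add_le_add hcb hd')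
      rw [eLpNorm_one_eq_lintegral_enorm] at hh
      exact hh.le
    _ = ε := by rw [← add_assoc, ENNReal.add_thirds]

end HasBoundedOrbitIntegrals

end AbstractFlow

end SpecialFlow
namespace SpecialFlow

/-! ### Orbit integrals, escape sets and zero returns -/

section OrbitIntegral

variable {X : Type*} [MeasurableSpace X] {T : ℝ → X → X} {μ : Measure X} {f : X → ℝ}

theorem orbitIntegral_add (hT : IsMeasurePreservingFlow T μ)
    (hfi : ∀ x a b, IntervalIntegrable (fun s => f (T s x)) volume a b) (s t : ℝ) (x : X) :
    orbitIntegral T f (s + t) x = orbitIntegral T f s x + orbitIntegral T f t (T s x) := by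
  simp only [orbitIntegral, ← hT.map_add]
  rw [intervalIntegral.integral_comp_add_left (fun u => f (T u x)), add_zero,
    intervalIntegral.integral_add_adjacent_intervals (hfi _ _ _) (hfi _ _ _)]

theorem continuous_orbitIntegral {Y : Type*} {T : ℝ → Y → Y} {f : Y → ℝ}
    (hfi : ∀ x a b, IntervalIntegrable (fun s => f (T s x)) volume a b) (x : Y) :
    Continuous fun t => orbitIntegral T f t x :=
  intervalIntegral.continuous_primitive (hfi x) 0

theorem measurable_orbitIntegral (hT : IsMeasurePreservingFlow T μ) (hf : Measurable f) (t : ℝ) :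
    Measurable (orbitIntegral T f t) := by
  have h : StronglyMeasurable (Function.uncurry fun x s => f (T s x)) :=
    (hf.comp hT.measurable_swap).stronglyMeasurable
  exact (h.integral_prod_right.sub h.integral_prod_right).measurable

theorem measurable_uncurry_orbitIntegral (hT : IsMeasurePreservingFlow T μ) (hf : Measurable f)
    (hfi : ∀ x a b, IntervalIntegrable (fun s => f (T s x)) volume a b) :
    Measurable (Function.uncurry (orbitIntegral T f)) :=
  measurable_uncurry_of_continuous_of_measurable (continuous_orbitIntegral hfi)
    (measurable_orbitIntegral hT hf)

/-- The points of `A` at which the orbit integral leaves the value `0` with speed at least `δ`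
during the time interval `(-δ, δ)`. -/
def escapeSet (T : ℝ → X → X) (f : X → ℝ) (A : Set X) (δ : ℝ) : Set X :=
  {x | x ∈ A ∧ ∀ t : ℝ, |t| < δ → δ * |t| ≤ |orbitIntegral T f t x|}

theorem measurableSet_escapeSet (hT : IsMeasurePreservingFlow T μ) (hf : Measurable f)
    (hfi : ∀ x a b, IntervalIntegrable (fun s => f (T s x)) volume a b) {A : Set X}
    (hA : MeasurableSet A) (δ : ℝ) : MeasurableSet (escapeSet T f A δ) := by
  -- Rational times suffice: they are dense in the open set `|t| < δ`, and the inequality is closed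
  -- in `t`.
  have h : escapeSet T f A δ =
      A ∩ ⋂ q : ℚ, {x | |(q : ℝ)| < δ → δ * |(q : ℝ)| ≤ |orbitIntegral T f q x|} := by
    ext x
    simp only [escapeSet, mem_ofPred_eq, mem_inter_iff, mem_iInter]
    refine and_congr_right fun _ => ⟨fun h q => h q, fun h t ht => ?_⟩
    have hopen : IsOpen {t : ℝ | |t| < δ} := isOpen_lt continuous_abs continuous_const
    have hclosed : IsClosed {t : ℝ | δ * |t| ≤ |orbitIntegral T f t x|} :=
      isClosed_le (by fun_prop) (continuous_orbitIntegral hfi x).abs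
    refine hclosed.closure_subset_iff.2 ?_
      (Rat.isDenseEmbedding_coe_real.dense.open_subset_closure_inter hopen ht)
    rintro _ ⟨hq, q, rfl⟩
    exact h q hq
  rw [h]
  refine hA.inter (MeasurableSet.iInter fun q => ?_)
  refine MeasurableSet.imp (MeasurableSet.const _) ?_
  exact measurableSet_le measurable_const
    (continuous_abs.measurable.comp (measurable_orbitIntegral hT hf q))

/-- Along an orbit, the orbit integral expands small distances between visits to the escape
set. -/
theorem mul_abs_sub_le_abs_orbitIntegral_sub (hT : IsMeasurePreservingFlow T μ)
    (hfi : ∀ x a b, IntervalIntegrable (fun s => f (T s x)) volume a b) {A : Set X} {δ : ℝ} {x : X}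
    {s s' : ℝ} (hs : T s x ∈ escapeSet T f A δ) (h : |s' - s| < δ) :
    δ * |s' - s| ≤ |orbitIntegral T f s' x - orbitIntegral T f s x| := by
  have h1 := orbitIntegral_add hT hfi s (s' - s) x
  rw [add_sub_cancel] at h1
  rw [h1, add_sub_cancel_left]
  exact hs.2 _ h

theorem abs_sub_lt_of_mem_Ico {a δ s s' : ℝ} (hs : s ∈ Ico a (a + δ)) (hs' : s' ∈ Ico a (a + δ)) :
    |s' - s| < δ := by
  rw [abs_lt]
  constructor <;> linarith [hs.1, hs.2, hs'.1, hs'.2]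

theorem injOn_orbitIntegral (hT : IsMeasurePreservingFlow T μ)
    (hfi : ∀ x a b, IntervalIntegrable (fun s => f (T s x)) volume a b) {A : Set X} {δ : ℝ}
    (hδ : 0 < δ) (x : X) (a : ℝ) :
    InjOn (fun t => orbitIntegral T f t x)
      {s | s ∈ Ico a (a + δ) ∧ T s x ∈ escapeSet T f A δ} := by
  rintro s ⟨hs, hsE⟩ s' ⟨hs', -⟩ heq
  have h := mul_abs_sub_le_abs_orbitIntegral_sub hT hfi hsE (abs_sub_lt_of_mem_Ico hs hs')
  simp only at heq
  rw [heq, sub_self, abs_zero] at h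
  have h2 : |s' - s| ≤ 0 := nonpos_of_mul_nonpos_right h hδ
  linarith [abs_nonpos_iff.1 h2]

/-- The set of points which return to `E` after time `N` with vanishing orbit integral. -/
def zeroReturnSet (T : ℝ → X → X) (f : X → ℝ) (E : Set X) (N : ℝ) : Set X :=
  {x | ∃ t, N ≤ t ∧ orbitIntegral T f t x = 0 ∧ T t x ∈ E}

/-- A projection along time is in general only analytic. In a window of length `δ`, however, each
point has at most one zero return to the escape set, so the projection is injective there and
Lusin–Souslin gives a Borel set. -/
theorem measurableSet_zeroReturnSet [StandardBorelSpace X] (hT : IsMeasurePreservingFlow T μ)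
    (hf : Measurable f) (hfi : ∀ x a b, IntervalIntegrable (fun s => f (T s x)) volume a b)
    {A : Set X} (hA : MeasurableSet A) {δ : ℝ} (hδ : 0 < δ) (N : ℝ) :
    MeasurableSet (zeroReturnSet T f (escapeSet T f A δ) N) := by
  set W : ℕ → Set (ℝ × X) := fun j => {p | p.1 ∈ Ico (N + j * δ) (N + j * δ + δ) ∧
    orbitIntegral T f p.1 p.2 = 0 ∧ T p.1 p.2 ∈ escapeSet T f A δ} with hW
  have hWm : ∀ j, MeasurableSet (W j) := fun j =>
    (measurable_fst measurableSet_Ico).inter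
      (((measurable_uncurry_orbitIntegral hT hf hfi) (measurableSet_singleton 0)).inter
        (hT.measurable_uncurry (measurableSet_escapeSet hT hf hfi hA δ)))
  have h : zeroReturnSet T f (escapeSet T f A δ) N = ⋃ j, Prod.snd '' W j := by
    ext x
    simp only [zeroReturnSet, mem_ofPred_eq, mem_iUnion, mem_image, Prod.exists,
      exists_eq_right, hW]
    constructor
    · rintro ⟨t, hN, h0, hE⟩
      have hpos : 0 ≤ (t - N) / δ := div_nonneg (sub_nonneg.2 hN) hδ.le
      refine ⟨⌊(t - N) / δ⌋₊, t, ⟨?_, ?_⟩, h0, hE⟩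
      · have := (le_div_iff₀ hδ).1 (Nat.floor_le hpos)
        linarith
      · have := (div_lt_iff₀ hδ).1 (Nat.lt_floor_add_one ((t - N) / δ))
        linarith
    · rintro ⟨j, t, ht, h0, hE⟩
      have : 0 ≤ j * δ := by positivity
      exact ⟨t, by linarith [ht.1], h0, hE⟩
  rw [h]
  refine MeasurableSet.iUnion fun j => (hWm j).image_of_measurable_injOn measurable_snd ?_
  rintro ⟨t, x⟩ ⟨ht, h0, hE⟩ ⟨t', x'⟩ ⟨ht', h0', hE'⟩ hx
  obtain rfl : x = x' := hx
  exact Prod.ext (injOn_orbitIntegral hT hfi hδ x _ ⟨ht, hE⟩ ⟨ht', hE'⟩ (h0.trans h0'.symm)) rfl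

/-- The inverse of `F` on the image is `δ⁻¹`-Lipschitz, and Lebesgue measure on the line is
one-dimensional Hausdorff measure. -/
theorem _root_.MeasureTheory.volume_le_mul_volume_image_of_expanding {F : ℝ → ℝ} {E : Set ℝ}
    {δ : ℝ} (hδ : 0 < δ) (h : ∀ s ∈ E, ∀ s' ∈ E, δ * |s' - s| ≤ |F s' - F s|) :
    volume E ≤ ENNReal.ofReal δ⁻¹ * volume (F '' E) := by
  have hinj : InjOn F E := fun s hs s' hs' heq => by
    have h1 := h s hs s' hs'
    rw [heq, sub_self, abs_zero] at h1
    linarith [abs_nonpos_iff.1 (nonpos_of_mul_nonpos_right h1 hδ)]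
  set G := Function.invFunOn F E with hG
  have hinv : LeftInvOn G F E := hinj.leftInvOn_invFunOn
  have hlip : LipschitzOnWith (Real.toNNReal δ⁻¹) G (F '' E) := by
    refine LipschitzOnWith.of_dist_le_mul ?_
    rintro _ ⟨s, hs, rfl⟩ _ ⟨s', hs', rfl⟩
    rw [hinv hs, hinv hs', Real.dist_eq, Real.dist_eq, Real.coe_toNNReal _ (by positivity),
      inv_mul_eq_div, le_div_iff₀ hδ, mul_comm]
    exact h s' hs' s hs
  have h1 := hlip.hausdorffMeasure_image_le (zero_le_one)
  rw [hinv.image_image, ENNReal.rpow_one, hausdorffMeasure_real] at h1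
  exact h1

theorem enorm_orbitIntegral_le {Y : Type*} {T : ℝ → Y → Y} {h : Y → ℝ} {t R : ℝ} (ht : 0 ≤ t)
    (htR : t ≤ R) (x : Y) :
    ‖orbitIntegral T h t x‖ₑ ≤ ∫⁻ s in Ioc 0 R, ‖h (T s x)‖ₑ := by
  rw [orbitIntegral, intervalIntegral.integral_of_le ht]
  exact (enorm_integral_le_lintegral_enorm _).trans
    (lintegral_mono_set (Ioc_subset_Ioc_right htR))

/-- The time that an orbit spends, during separated short intervals, in a set of points of the
escape set without late zero returns is controlled by the range of the orbit integral. -/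
theorem sum_volume_visits_le (hT : IsMeasurePreservingFlow T μ)
    (hfi : ∀ x a b, IntervalIntegrable (fun s => f (T s x)) volume a b) {A B : Set X}
    (hBm : MeasurableSet B) {δ N : ℝ} (hδ : 0 < δ) (hN : 0 ≤ N) (hBA : B ⊆ escapeSet T f A δ)
    (hB : ∀ x ∈ B, ∀ t, N ≤ t → orbitIntegral T f t x = 0 → T t x ∉ B) (x : X) (K : ℕ)
    {R : ENNReal} (hR : ∀ t, 0 ≤ t → t ≤ K * (N + δ) → ‖orbitIntegral T f t x‖ₑ ≤ R) :
    ∑ k ∈ Finset.range K, volume {s | s ∈ Ico (k * (N + δ)) (k * (N + δ) + δ) ∧ T s x ∈ B} ≤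
      ENNReal.ofReal δ⁻¹ * (2 * R) := by
  set F : ℝ → ℝ := fun t => orbitIntegral T f t x with hF
  set E : ℕ → Set ℝ := fun k => {s | s ∈ Ico (k * (N + δ)) (k * (N + δ) + δ) ∧ T s x ∈ B} with hE
  have hEm : ∀ k, MeasurableSet (E k) := fun k =>
    measurableSet_Ico.inter (hT.measurable_orbit x hBm)
  have hinj : ∀ k, InjOn F (E k) := by
    intro k
    refine InjOn.mono ?_ (injOn_orbitIntegral hT hfi (A := A) hδ x (k * (N + δ)))
    exact fun s hs => ⟨hs.1, hBA hs.2⟩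
  have hvol : ∀ k, volume (E k) ≤ ENNReal.ofReal δ⁻¹ * volume (F '' E k) := fun k =>
    volume_le_mul_volume_image_of_expanding hδ fun s hs s' hs' =>
      mul_abs_sub_le_abs_orbitIntegral_sub hT hfi (hBA hs.2) (abs_sub_lt_of_mem_Ico hs.1 hs'.1)
  -- A common value at `s < s'` makes the orbit integral from `s` to `s'` vanish, with both ends in
  -- `B` and `s' - s ≥ N` because of the gaps; `hB` forbids this.
  have hlt : ∀ k k', k < k' → Disjoint (F '' E k) (F '' E k') := by
    intro k k' hkk
    rw [Set.disjoint_left]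
    rintro _ ⟨s, hs, rfl⟩ ⟨s', hs', heq⟩
    have hk : (k : ℝ) + 1 ≤ k' := by exact_mod_cast hkk
    have hsep : N ≤ s' - s := by
      have h1 := hs.1.2
      have h2 := hs'.1.1
      have h3 : ((k : ℝ) + 1) * (N + δ) ≤ k' * (N + δ) :=
        mul_le_mul_of_nonneg_right hk (by linarith)
      linarith
    have h1 := orbitIntegral_add hT hfi s (s' - s) x
    rw [add_sub_cancel] at h1
    refine hB _ hs.2 (s' - s) hsep ?_ ?_
    · simp only [hF] at heq
      linarith
    · rw [← hT.map_add, add_sub_cancel]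
      exact hs'.2
  have hdisj : ((Finset.range K : Finset ℕ) : Set ℕ).PairwiseDisjoint fun k => F '' E k := by
    intro k _ k' _ hne
    rcases lt_or_gt_of_ne hne with h | h
    · exact hlt k k' h
    · exact (hlt k' k h).symm
  calc ∑ k ∈ Finset.range K, volume (E k)
      ≤ ∑ k ∈ Finset.range K, ENNReal.ofReal δ⁻¹ * volume (F '' E k) :=
        Finset.sum_le_sum fun k _ => hvol k
    _ = ENNReal.ofReal δ⁻¹ * volume (⋃ k ∈ Finset.range K, F '' E k) := by
      rw [measure_biUnion_finset hdisj fun k _ => (hEm k).image_of_continuousOn_injOn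
        (continuous_orbitIntegral hfi x).continuousOn (hinj k), Finset.mul_sum]
    _ ≤ ENNReal.ofReal δ⁻¹ * (2 * R) := by
      refine mul_le_mul_right ?_ _
      -- All values lie within `R` of `0`; extended balls allow `R = ∞`.
      rw [← Real.volume_closedEBall 0 R]
      refine measure_mono (iUnion₂_subset fun k hk => ?_)
      rintro _ ⟨s, hs, rfl⟩
      rw [Metric.mem_closedEBall, edist_zero_right]
      have hk : (k : ℝ) + 1 ≤ K := by exact_mod_cast Finset.mem_range.1 hk
      have h3 : ((k : ℝ) + 1) * (N + δ) ≤ K * (N + δ) :=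
        mul_le_mul_of_nonneg_right hk (by linarith)
      have h4 : 0 ≤ (k : ℝ) * (N + δ) := by positivity
      exact hR s (h4.trans hs.1.1) (by linarith [hs.1.2])

/-- Divide by `K`, let `K → ∞`, then `ε → 0`. If `a > 0`, the choice `ε = a / (2(b + 1))` makes `b ε
≤ a / 2`, also for `b = 0`. -/
theorem _root_.Real.nonpos_of_forall_exists_nat_mul_le {a b : ℝ} (hb : 0 ≤ b)
    (h : ∀ ε > 0, ∃ C : ℝ, ∀ K : ℕ, K * a ≤ C + K * (b * ε)) : a ≤ 0 := by
  by_contra! ha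
  obtain ⟨C, hC⟩ := h (a / (2 * (b + 1))) (by positivity)
  obtain ⟨K, hK⟩ := exists_nat_gt (C / (a / 2))
  rw [div_lt_iff₀ (by positivity)] at hK
  have h1 : b * (a / (2 * (b + 1))) ≤ a / 2 := by
    rw [mul_div_assoc', div_le_div_iff₀ (by positivity) (by positivity)]
    nlinarith
  have h2 := mul_le_mul_of_nonneg_left h1 (Nat.cast_nonneg (α := ℝ) K)
  linarith [hC K]

/-- With `g` close to `f` in `L¹`, the range up to time `K(N + δ)` is bounded by `C`, independent of
`K`, plus the integral of `|f - g|` along the orbit. Integrating the visit bound over `μ` yields `K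
δ μ(B) ≤ 2 δ⁻¹ (C + K(N + δ) ε)`. -/
theorem measure_eq_zero_of_forall_orbitIntegral_ne_zero [IsProbabilityMeasure μ]
    (hT : IsMeasurePreservingFlow T μ) (herg : IsErgodicFlow T μ) (hf : Measurable f)
    (hfμ : Integrable f μ) (hf0 : ∫ x, f x ∂μ = 0)
    (hfi : ∀ x a b, IntervalIntegrable (fun s => f (T s x)) volume a b) {A B : Set X}
    (hBm : MeasurableSet B) {δ N : ℝ} (hδ : 0 < δ) (hN : 0 ≤ N) (hBA : B ⊆ escapeSet T f A δ)
    (hB : ∀ x ∈ B, ∀ t, N ≤ t → orbitIntegral T f t x = 0 → T t x ∉ B) : μ B = 0 := by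
  have key : ∀ ε > 0, ∃ C : ℝ, ∀ K : ℕ,
      K * (δ * μ.real B) ≤ C + K * ((δ⁻¹ * 2 * (N + δ)) * ε) := by
    intro ε hε
    obtain ⟨g, hg, hgε⟩ := HasBoundedOrbitIntegrals.exists_lintegral_sub_le hT herg hfμ hf0
      (ε := ENNReal.ofReal ε) (by simpa using hε)
    obtain ⟨C, hC⟩ := hg.bounded_orbitIntegral
    have hX : Nonempty X := nonempty_of_isProbabilityMeasure μ
    have hC0 : 0 ≤ C := (abs_nonneg _).trans (hC 0 hX.some)
    refine ⟨δ⁻¹ * 2 * C, fun K => ?_⟩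
    have hL : 0 ≤ K * (N + δ) := by positivity
    have hpt := fun x => sum_volume_visits_le hT hfi hBm hδ hN hBA hB x K
      (R := ENNReal.ofReal C + ∫⁻ s in Ioc 0 (K * (N + δ)), ‖f (T s x) - g (T s x)‖ₑ) (by
        intro t ht htK
        have h1 : orbitIntegral T f t x
            = orbitIntegral T g t x + orbitIntegral T (fun y => f y - g y) t x := by
          simp only [orbitIntegral]
          rw [intervalIntegral.integral_sub (hfi x 0 t) (hg.intervalIntegrable hT x 0 t)]
          ring
        rw [h1]
        refine (enorm_add_le _ _).trans (add_le_add ?_ (enorm_orbitIntegral_le ht htK x))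
        rw [Real.enorm_eq_ofReal_abs]
        exact ENNReal.ofReal_le_ofReal (hC t x))
    have hind : ∀ (J : Set ℝ) x, MeasurableSet J → volume {s | s ∈ J ∧ T s x ∈ B} =
        ∫⁻ s in J, B.indicator 1 (T s x) := by
      intro J x hJ
      have hm : MeasurableSet {s | T s x ∈ B} := hT.measurable_orbit x hBm
      have : (fun s => B.indicator (1 : X → ENNReal) (T s x))
          = {s | T s x ∈ B}.indicator 1 := by
        ext s; by_cases h : T s x ∈ B <;> simp [h]
      rw [this, lintegral_indicator_one hm, Measure.restrict_apply hm, inter_comm]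
      rfl
    have hB1 : Measurable (B.indicator (1 : X → ENNReal)) := measurable_one.indicator hBm
    have hint := lintegral_mono (μ := μ) hpt
    simp_rw [hind _ _ measurableSet_Ico] at hint
    have hfg : Measurable fun y => ‖f y - g y‖ₑ := (hf.sub hg.measurable).enorm
    rw [lintegral_finsetSum' _ (fun k _ => by
        have : Measurable (Function.uncurry fun x s => B.indicator (1 : X → ENNReal) (T s x)) :=
          hB1.comp hT.measurable_swap
        exact this.lintegral_prod_right.aemeasurable)] at hint
    simp_rw [hT.lintegral_setLIntegral_orbit hB1, lintegral_indicator_one hBm] at hint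
    rw [lintegral_const_mul' _ _ ENNReal.ofReal_ne_top, lintegral_const_mul' _ _ (by simp),
      lintegral_add_left measurable_const,
      hT.lintegral_setLIntegral_orbit hfg] at hint
    simp only [Real.volume_Ico, Real.volume_Ioc, add_sub_cancel_left, sub_zero, Finset.sum_const,
      Finset.card_range, nsmul_eq_mul, lintegral_const, measure_univ, mul_one] at hint
    have hint2 := hint.trans (mul_le_mul_right (mul_le_mul_right (add_le_add_right
      (mul_le_mul_right hgε _) _) _) _)
    rw [← ofReal_measureReal (measure_ne_top μ B), ← ENNReal.ofReal_mul hδ.le,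
      ← ENNReal.ofReal_natCast, ← ENNReal.ofReal_mul (Nat.cast_nonneg K),
      ← ENNReal.ofReal_mul hL, ← ENNReal.ofReal_add hC0 (by positivity),
      ← ENNReal.ofReal_ofNat, ← ENNReal.ofReal_mul (by norm_num),
      ← ENNReal.ofReal_mul (by positivity), ENNReal.ofReal_le_ofReal_iff (by positivity)] at hint2
    refine hint2.trans (le_of_eq ?_)
    ring
  have h1 := Real.nonpos_of_forall_exists_nat_mul_le (by positivity) key
  have h2 : μ.real B = 0 := le_antisymm (nonpos_of_mul_nonpos_right h1 hδ) measureReal_nonneg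
  exact (measureReal_eq_zero_iff).1 h2

theorem exists_mem_escapeSet_of_hasDerivAt {Y : Type*} {T : ℝ → Y → Y} {f : Y → ℝ} {A : Set Y}
    {x : Y} (hx : x ∈ A) {c : ℝ} (hc : c ≠ 0)
    (h : HasDerivAt (fun t => orbitIntegral T f t x) c 0) :
    ∃ n : ℕ, x ∈ escapeSet T f A (1 / ((n : ℝ) + 1)) := by
  have h1 := (hasDerivAt_iff_isLittleO.1 h).def (c := |c| / 2) (by positivity)
  obtain ⟨ε, hε, hball⟩ := Metric.eventually_nhds_iff.1 h1
  -- `1 / (n + 1)` serves both as time range and as speed, so it must be below `ε` and below `|c| /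
  -- 2`.
  obtain ⟨n, hn⟩ := exists_nat_one_div_lt (lt_min hε (show 0 < |c| / 2 by positivity))
  refine ⟨n, hx, fun t ht => ?_⟩
  have h2 := hball (y := t) (by simpa using ht.trans (hn.trans_le (min_le_left _ _)))
  simp only [orbitIntegral, intervalIntegral.integral_same, sub_zero, smul_eq_mul,
    Real.norm_eq_abs] at h2
  have h3 : 1 / ((n : ℝ) + 1) * |t| ≤ |c| / 2 * |t| :=
    mul_le_mul_of_nonneg_right (hn.le.trans (min_le_right _ _)) (abs_nonneg t)
  have h4 : |t * c| - |(∫ s in (0 : ℝ)..t, f (T s x)) - t * c| ≤ |∫ s in (0 : ℝ)..t, f (T s x)| := by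
    have := abs_sub_abs_le_abs_sub (t * c) (∫ s in (0 : ℝ)..t, f (T s x))
    rw [abs_sub_comm] at this
    linarith
  rw [abs_mul] at h4
  simp only [orbitIntegral]
  linarith

/-- On every orbit, almost every time is a Lebesgue point; Fubini turns this into a statement about
almost every point. -/
theorem ae_exists_mem_escapeSet [SFinite μ] (hT : IsMeasurePreservingFlow T μ) (hf : Measurable f)
    (hfi : ∀ x a b, IntervalIntegrable (fun s => f (T s x)) volume a b) {A : Set X}
    (hA : MeasurableSet A) :
    ∀ᵐ x ∂μ, x ∈ A → f x ≠ 0 → ∃ n : ℕ, x ∈ escapeSet T f A (1 / ((n : ℝ) + 1)) := by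
  set Z : Set X := (A ∩ {x | f x ≠ 0}) \ ⋃ n : ℕ, escapeSet T f A (1 / ((n : ℝ) + 1)) with hZ
  have hZm : MeasurableSet Z := (hA.inter (hf (measurableSet_singleton 0).compl)).diff
    (MeasurableSet.iUnion fun n => measurableSet_escapeSet hT hf hfi hA _)
  have hnull : μ Z = 0 := by
    refine hT.measure_eq_zero_of_ae_ae_orbit hZm (Eventually.of_forall fun x => ?_)
    have hloc : LocallyIntegrable (fun s => f (T s x)) volume :=
      fun s =>
      ⟨Ioc (s - 1) (s + 1), Ioc_mem_nhds (by linarith) (by linarith), (hfi x _ _).1⟩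
    filter_upwards [LocallyIntegrable.ae_hasDerivAt_integral hloc] with s hs hsZ
    obtain ⟨⟨hsA, hs0⟩, hsn⟩ := hsZ
    refine hsn (mem_iUnion.2 (exists_mem_escapeSet_of_hasDerivAt hsA hs0 ?_))
    -- The cocycle identity turns the derivative at time `s` for `x` into the derivative at time `0`
    -- for `T s x`.
    have h1 := hs 0
    rw [← add_zero s] at h1
    have h2 := (h1.comp_const_add s 0).sub_const (orbitIntegral T f s x)
    rw [add_zero] at h2
    refine h2.congr_of_eventuallyEq (Eventually.of_forall fun t => ?_)
    have h3 := orbitIntegral_add hT hfi s t x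
    simp only [orbitIntegral] at h3 ⊢
    linarith
  filter_upwards [measure_eq_zero_iff_ae_notMem.1 hnull] with x hx hxA hx0
  by_contra h
  exact hx ⟨⟨hxA, hx0⟩, fun h' => h (mem_iUnion.1 h')⟩

/-- Zero returns for a measurable function which is locally integrable along all orbits. -/
theorem ae_exists_zero_returns_of_measurable [StandardBorelSpace X] [IsProbabilityMeasure μ]
    (hT : IsMeasurePreservingFlow T μ) (herg : IsErgodicFlow T μ) (hf : Measurable f)
    (hfμ : Integrable f μ) (hf0 : ∫ x, f x ∂μ = 0)
    (hfi : ∀ x a b, IntervalIntegrable (fun s => f (T s x)) volume a b) {A : Set X}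
    (hA : MeasurableSet A) :
    ∀ᵐ x ∂μ, x ∈ A → f x ≠ 0 → ∀ N : ℕ, x ∈ zeroReturnSet T f A N := by
  have h : ∀ n N : ℕ, ∀ᵐ x ∂μ, x ∈ escapeSet T f A (1 / ((n : ℝ) + 1)) →
      x ∈ zeroReturnSet T f (escapeSet T f A (1 / ((n : ℝ) + 1))) N := by
    intro n N
    have hδ : 0 < 1 / ((n : ℝ) + 1) := by positivity
    have hm := measurableSet_escapeSet hT hf hfi hA (1 / ((n : ℝ) + 1))
    -- A late zero return to the exceptional part would in particular be one to the escape set.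
    have h0 := measure_eq_zero_of_forall_orbitIntegral_ne_zero hT herg hf hfμ hf0 hfi (A := A)
      (hm.diff (measurableSet_zeroReturnSet hT hf hfi hA hδ N)) hδ (Nat.cast_nonneg N)
      sdiff_subset (fun x hx t ht h0 hxt => hx.2 ⟨t, ht, h0, hxt.1⟩)
    filter_upwards [measure_eq_zero_iff_ae_notMem.1 h0] with x hx hxE
    by_contra h'
    exact hx ⟨hxE, h'⟩
  filter_upwards [ae_exists_mem_escapeSet hT hf hfi hA, ae_all_iff.2 fun n => ae_all_iff.2 (h n)]
    with x h1 h2 hxA hx0 N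
  obtain ⟨n, hn⟩ := h1 hxA hx0
  obtain ⟨t, ht, h0, hE⟩ := h2 n N hn
  exact ⟨t, ht, h0, hE.1⟩

theorem _root_.MeasureTheory.intervalIntegrable_of_forall_nat {g : ℝ → ℝ}
    (h : ∀ n : ℕ, IntervalIntegrable g volume (-n) n) (a b : ℝ) :
    IntervalIntegrable g volume a b := by
  obtain ⟨n, hn⟩ := exists_nat_ge (max |a| |b|)
  have ha := abs_le.1 ((le_max_left _ _).trans hn)
  have hb := abs_le.1 ((le_max_right _ _).trans hn)
  refine (h n).mono_set ?_
  rw [uIcc_of_le (show -(n : ℝ) ≤ n by linarith)]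
  exact uIcc_subset_Icc ha hb

/-- An integrable function agrees almost everywhere with a measurable function which is locally
integrable along all orbits. -/
theorem exists_measurable_ae_eq_intervalIntegrable [SFinite μ] (hT : IsMeasurePreservingFlow T μ)
    (hf : Integrable f μ) :
    ∃ g : X → ℝ, Measurable g ∧ f =ᵐ[μ] g ∧
      ∀ x a b, IntervalIntegrable (fun s => g (T s x)) volume a b := by
  obtain ⟨g, hgm, hfg⟩ : ∃ g, Measurable g ∧ f =ᵐ[μ] g := hf.1.aemeasurable
  have hgi : Integrable g μ := hf.congr hfg
  set Ω : Set X := {x | ∀ n : ℕ, IntervalIntegrable (fun s => g (T s x)) volume (-n) n} with hΩ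
  have hsm : StronglyMeasurable (Function.uncurry fun x s => g (T s x)) :=
    (hgm.comp hT.measurable_swap).stronglyMeasurable
  have hΩm : MeasurableSet Ω := by
    have : Ω = ⋂ n : ℕ, {x | Integrable (fun s => g (T s x)) (volume.restrict (uIoc (-(n : ℝ)) n))} := by
      ext x
      simp only [hΩ, mem_ofPred_eq, mem_iInter, intervalIntegrable_iff, IntegrableOn]
    rw [this]
    exact MeasurableSet.iInter fun n => measurableSet_integrable hsm
  have hΩae : ∀ᵐ x ∂μ, x ∈ Ω := by
    refine ae_all_iff.2 fun n => ?_
    have h1 := hT.lintegral_setLIntegral_orbit hgm.enorm (uIoc (-(n : ℝ)) n)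
    have h2 : ∫⁻ x, (∫⁻ s in uIoc (-(n : ℝ)) n, ‖g (T s x)‖ₑ) ∂μ ≠ ⊤ := by
      rw [h1, uIoc_of_le (by linarith [Nat.cast_nonneg (α := ℝ) n]), Real.volume_Ioc]
      exact ENNReal.mul_ne_top ENNReal.ofReal_ne_top hgi.2.ne
    have h3 : Measurable (Function.uncurry fun x s => ‖g (T s x)‖ₑ) :=
      hgm.enorm.comp hT.measurable_swap
    filter_upwards [ae_lt_top h3.lintegral_prod_right h2] with x hx
    rw [intervalIntegrable_iff]
    exact ⟨(hgm.comp (hT.measurable_orbit x)).aestronglyMeasurable, hx⟩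
  have hΩinv : ∀ x ∈ Ω, ∀ s, T s x ∈ Ω := by
    intro x hx s n
    have h1 := (intervalIntegrable_of_forall_nat hx (-n + s) (n + s)).comp_add_left s
    simpa only [hT.map_add, add_sub_cancel_right] using h1
  have hΩinv' : ∀ x s, T s x ∈ Ω → x ∈ Ω := by
    intro x s h
    have := hΩinv _ h (-s)
    rwa [← hT.map_add, add_neg_cancel, hT.map_zero] at this
  -- Since `Ω` is invariant, the new function is `g` along a whole orbit or zero along a whole
  -- orbit.
  refine ⟨Ω.indicator g, hgm.indicator hΩm, ?_, fun x a b => ?_⟩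
  · filter_upwards [hfg, hΩae] with x h1 h2
    rw [h1, indicator_of_mem h2]
  · by_cases hx : x ∈ Ω
    · simp_rw [indicator_of_mem (hΩinv x hx _)]
      exact intervalIntegrable_of_forall_nat hx a b
    · simp_rw [indicator_of_notMem fun h => hx (hΩinv' x _ h)]
      exact intervalIntegrable_const

/-- Over an ergodic flow, the orbit integrals of an integrable function of mean zero vanish at
arbitrarily late returns to `A`, for almost every point of `A` at which the function does not
vanish. -/
theorem ae_exists_zero_returns [StandardBorelSpace X] [IsProbabilityMeasure μ]
    (hT : IsMeasurePreservingFlow T μ) (herg : IsErgodicFlow T μ) (hfμ : Integrable f μ)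
    (hf0 : ∫ x, f x ∂μ = 0) {A : Set X} (hA : NullMeasurableSet A μ) :
    ∀ᵐ x ∂μ, x ∈ A → f x ≠ 0 → ∃ t : ℕ → ℝ, Tendsto t atTop atTop ∧
      ∀ k, IntervalIntegrable (fun s => f (T s x)) volume 0 (t k) ∧
        orbitIntegral T f (t k) x = 0 ∧ T (t k) x ∈ A := by
  obtain ⟨g, hgm, hfg, hgi⟩ := exists_measurable_ae_eq_intervalIntegrable hT hfμ
  obtain ⟨A', hA'A, hA'm, hA'⟩ := hA.exists_measurable_subset_ae_eq
  have hg0 : ∫ x, g x ∂μ = 0 := by rw [← hf0, integral_congr_ae hfg]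
  filter_upwards [ae_exists_zero_returns_of_measurable hT herg hgm (hfμ.congr hfg) hg0 hgi hA'm,
    hfg, hT.ae_ae_orbit hfg, hA'.mem_iff] with x h1 h2 h3 h4 hxA hx0
  choose t ht ht0 htA using h1 (h4.2 hxA) (h2 ▸ hx0)
  refine ⟨t, tendsto_atTop_mono ht tendsto_natCast_atTop_atTop, fun k => ⟨?_, ?_, hA'A (htA k)⟩⟩
  · refine (hgi x 0 (t k)).congr_ae (ae_restrict_of_ae ?_)
    filter_upwards [h3] with s hs using hs.symm
  · rw [← ht0 k]
    refine intervalIntegral.integral_congr_ae ?_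
    filter_upwards [h3] with s hs _ using hs

end OrbitIntegral

end SpecialFlow
namespace SpecialFlow

/-! ### The roof cocycle and complete vertical lines -/

section RoofSum

variable {S : I ≃ᵐ I} {r : I → ℝ}

theorem roofSum_zero (S : I ≃ᵐ I) (r : I → ℝ) (a : I) : roofSum S r a 0 = 0 := by
  change roofSum S r a (Int.ofNat 0) = 0
  simp [roofSum]

theorem roofSum_add (S : I ≃ᵐ I) (r : I → ℝ) (a : I) (m n : ℤ) :
    roofSum S r a (m + n) =
      roofSum S r a m + roofSum S r ((S.toEquiv ^ m : Equiv.Perm I) a) n := by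
  have hstep : ∀ k : ℤ, roofSum S r a (m + (k + 1)) -
      roofSum S r ((S.toEquiv ^ m : Equiv.Perm I) a) (k + 1) = roofSum S r a (m + k) -
      roofSum S r ((S.toEquiv ^ m : Equiv.Perm I) a) k := by
    intro k
    rw [← add_assoc, roofSum_add_one, roofSum_add_one, ← Equiv.Perm.mul_apply, ← zpow_add,
      add_comm k m]
    ring
  have h : roofSum S r a (m + n) - roofSum S r ((S.toEquiv ^ m : Equiv.Perm I) a) n =
      roofSum S r a m := by
    induction n using Int.induction_on with
    | zero => rw [add_zero, roofSum_zero, sub_zero]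
    | succ k ih => rw [hstep, ih]
    | pred k ih => rw [← ih, ← hstep (-k - 1), sub_add_cancel]
  linarith

theorem roofSum_monotone (hr : ∀ a, 0 ≤ r a) (a : I) : Monotone (roofSum S r a) :=
  monotone_int_of_le_succ fun n => by
    rw [roofSum_add_one]
    linarith [hr ((S.toEquiv ^ n : Equiv.Perm I) a)]

/-- Since `r ≥ 0`, the half-open intervals between successive roof sums are disjoint, some possibly
empty. Hence the integer chosen in `flow` may be replaced by any admissible one. -/
theorem eq_of_roofSum_le_lt (hr : ∀ a, 0 ≤ r a) {a : I} {u : ℝ} {m n : ℤ}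
    (hm : roofSum S r a m ≤ u ∧ u < roofSum S r a (m + 1))
    (hn : roofSum S r a n ≤ u ∧ u < roofSum S r a (n + 1)) : m = n := by
  have key : ∀ i j : ℤ, roofSum S r a i ≤ u → u < roofSum S r a (j + 1) → i ≤ j := by
    intro i j hi hj
    by_contra! h
    linarith [roofSum_monotone (S := S) hr a (show j + 1 ≤ i by lia)]
  exact le_antisymm (key m n hm.1 hn.2) (key n m hn.1 hm.2)

theorem measurePreserving_zpow (hS : MeasurePreserving S volume volume) (n : ℤ) :
    MeasurePreserving (S.toEquiv ^ n : Equiv.Perm I) volume volume := by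
  have hS' : MeasurePreserving (S.toEquiv⁻¹ : Equiv.Perm I) volume volume := hS.symm
  induction n using Int.induction_on with
  | zero => exact MeasurePreserving.id volume
  | succ k ih => rw [zpow_add_one]; exact ih.comp hS
  | pred k ih => rw [zpow_sub_one]; exact ih.comp hS'

theorem measurable_roofSum (hS : MeasurePreserving S volume volume) (hr : Measurable r) (n : ℤ) :
    Measurable fun a => roofSum S r a n := by
  rcases n with n | n
  · exact Finset.measurable_sum _ fun i _ => hr.comp (measurePreserving_zpow hS _).measurable
  · exact (Finset.measurable_sum _ fun i _ =>
      hr.comp (measurePreserving_zpow hS _).measurable).neg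

/-- Monotonicity reduces the condition for all real `u` to countably many unboundedness conditions,
which gives measurability. -/
theorem isComplete_iff (hr : ∀ a, 0 ≤ r a) (a : I) :
    IsComplete S r a ↔
      (∀ k : ℕ, ∃ n, (k : ℝ) < roofSum S r a n) ∧ ∀ k : ℕ, ∃ n, roofSum S r a n ≤ -k := by
  constructor
  · intro h
    exact ⟨fun k => (h k).elim fun n hn => ⟨n + 1, hn.2⟩, fun k => (h (-k)).imp fun n hn => hn.1⟩
  · rintro ⟨h1, h2⟩ u
    obtain ⟨k, hk⟩ := exists_nat_ge |u|
    obtain ⟨i, hi⟩ := h1 k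
    obtain ⟨j, hj⟩ := h2 k
    have hu := abs_le.1 hk
    obtain ⟨n, hn, hmax⟩ := Int.exists_greatest_of_bdd (P := fun n => roofSum S r a n ≤ u)
      ⟨i, fun n hn => by
        by_contra! h
        linarith [roofSum_monotone (S := S) hr a h.le]⟩ ⟨j, by linarith⟩
    refine ⟨n, hn, ?_⟩
    by_contra! h
    have := hmax _ h
    lia

theorem measurableSet_isComplete (hS : MeasurePreserving S volume volume) (hr : Measurable r)
    (hr0 : ∀ a, 0 ≤ r a) : MeasurableSet {a | IsComplete S r a} := by
  have h : {a | IsComplete S r a} = (⋂ k : ℕ, ⋃ n, {a | (k : ℝ) < roofSum S r a n}) ∩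
      ⋂ k : ℕ, ⋃ n, {a | roofSum S r a n ≤ -k} := by
    ext a
    simp [isComplete_iff hr0]
  rw [h]
  refine MeasurableSet.inter ?_ ?_
  · exact MeasurableSet.iInter fun k => MeasurableSet.iUnion fun n =>
      measurableSet_lt measurable_const (measurable_roofSum hS hr n)
  · exact MeasurableSet.iInter fun k => MeasurableSet.iUnion fun n =>
      measurableSet_le (measurable_roofSum hS hr n) measurable_const

theorem IsComplete.zpow {a : I} (h : IsComplete S r a) (m : ℤ) :
    IsComplete S r ((S.toEquiv ^ m : Equiv.Perm I) a) := by
  intro u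
  obtain ⟨n, hn1, hn2⟩ := h (u + roofSum S r a m)
  refine ⟨n - m, ?_, ?_⟩
  · have := roofSum_add S r a m (n - m)
    rw [add_sub_cancel] at this
    linarith
  · have := roofSum_add S r a m (n - m + 1)
    rw [← add_assoc, add_sub_cancel] at this
    linarith

end RoofSum

/-! ### The special flow as a measure-preserving flow -/

section Flow

variable {S : I ≃ᵐ I} {r : I → ℝ}

theorem measurableSet_phaseSpace (hr : Measurable r) : MeasurableSet (phaseSpace r) :=
  (measurableSet_le measurable_const measurable_snd).inter
    (measurableSet_lt measurable_snd (hr.comp measurable_fst))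

theorem flow_of_not_isComplete {x : phaseSpace r} (h : ¬IsComplete S r x.1.1) (t : ℝ) :
    flow S r t x = x := by
  rw [flow, dif_neg h]

/-- The map that moves a point upwards by `t` and then applies the `n`-th identification. -/
def shiftMap (S : I ≃ᵐ I) (r : I → ℝ) (t : ℝ) (n : ℤ) (p : I × ℝ) : I × ℝ :=
  ((S.toEquiv ^ n : Equiv.Perm I) p.1, p.2 + t - roofSum S r p.1 n)

theorem coe_flow_eq_shiftMap (hr : ∀ a, 0 ≤ r a) {x : phaseSpace r} (h : IsComplete S r x.1.1)
    {t : ℝ} {n : ℤ}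
    (hn : roofSum S r x.1.1 n ≤ x.1.2 + t ∧ x.1.2 + t < roofSum S r x.1.1 (n + 1)) :
    (flow S r t x : I × ℝ) = shiftMap S r t n x := by
  have h1 := eq_of_roofSum_le_lt hr (h (x.1.2 + t)).choose_spec hn
  rw [flow, dif_pos h]
  simp only [h1, shiftMap]

theorem flow_zero (hr : ∀ a, 0 ≤ r a) (x : phaseSpace r) : flow S r 0 x = x := by
  by_cases h : IsComplete S r x.1.1
  · refine Subtype.ext ?_
    have h0 : roofSum S r x.1.1 (0 + 1) = r x.1.1 := by
      rw [roofSum_add_one, roofSum_zero, zero_add]; rfl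
    rw [coe_flow_eq_shiftMap hr h (n := 0)
      (by rw [h0, roofSum_zero, add_zero]; exact x.2)]
    simp [shiftMap, roofSum_zero]
  · exact flow_of_not_isComplete h 0

theorem flow_add (hr : ∀ a, 0 ≤ r a) (s t : ℝ) (x : phaseSpace r) :
    flow S r (s + t) x = flow S r t (flow S r s x) := by
  by_cases h : IsComplete S r x.1.1
  · obtain ⟨n, hn⟩ := h (x.1.2 + s)
    have hy := coe_flow_eq_shiftMap hr h hn
    have hy1 : (flow S r s x).1.1 = (S.toEquiv ^ n : Equiv.Perm I) x.1.1 := congrArg Prod.fst hy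
    have hy2 : (flow S r s x).1.2 = x.1.2 + s - roofSum S r x.1.1 n := congrArg Prod.snd hy
    have hyc : IsComplete S r (flow S r s x).1.1 := hy1 ▸ h.zpow n
    obtain ⟨m, hm⟩ := hyc ((flow S r s x).1.2 + t)
    refine Subtype.ext ?_
    have hadd := roofSum_add S r x.1.1 n m
    have hadd1 := roofSum_add S r x.1.1 n (m + 1)
    rw [coe_flow_eq_shiftMap hr hyc hm]
    rw [hy1, hy2] at hm
    rw [coe_flow_eq_shiftMap hr h (n := n + m) ⟨by linarith, by rw [add_assoc n]; linarith⟩]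
    refine Prod.ext ?_ ?_
    · simp only [shiftMap]
      rw [hy1, ← Equiv.Perm.mul_apply, ← zpow_add, add_comm m n]
    · simp only [shiftMap]
      rw [hy1, hy2, hadd]
      ring
  · simp only [flow_of_not_isComplete h]

theorem measurable_shiftMap (hS : MeasurePreserving S volume volume) (hr : Measurable r) (n : ℤ) :
    Measurable fun q : ℝ × (I × ℝ) => shiftMap S r q.1 n q.2 := by
  have h1 := (measurePreserving_zpow hS n).measurable
  have h2 := measurable_roofSum hS hr n
  exact (h1.comp (measurable_fst.comp measurable_snd)).prodMk
    (((measurable_snd.comp measurable_snd).add measurable_fst).sub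
      (h2.comp (measurable_fst.comp measurable_snd)))

/-- The points of the phase space which are moved during the time `t` through `n` identifications;
for `n = none`, the points on lines which cannot be followed for all times. -/
def flowPiece (S : I ≃ᵐ I) (r : I → ℝ) : Option ℤ → Set (ℝ × phaseSpace r)
  | none => {q | ¬IsComplete S r q.2.1.1}
  | some n => {q | IsComplete S r q.2.1.1 ∧ roofSum S r q.2.1.1 n ≤ q.2.1.2 + q.1 ∧
      q.2.1.2 + q.1 < roofSum S r q.2.1.1 (n + 1)}

theorem measurableSet_flowPiece (hS : MeasurePreserving S volume volume) (hr : Measurable r)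
    (hr0 : ∀ a, 0 ≤ r a) (i : Option ℤ) : MeasurableSet (flowPiece S r i) := by
  have hval : Measurable fun q : ℝ × phaseSpace r => (q.2 : I × ℝ) :=
    measurable_subtype_coe.comp measurable_snd
  have h1 : MeasurableSet {q : ℝ × phaseSpace r | IsComplete S r q.2.1.1} :=
    (measurable_fst.comp hval) (measurableSet_isComplete hS hr hr0)
  have h2 : ∀ n, Measurable fun q : ℝ × phaseSpace r => roofSum S r q.2.1.1 n := fun n =>
    (measurable_roofSum hS hr n).comp (measurable_fst.comp hval)
  have h3 : Measurable fun q : ℝ × phaseSpace r => q.2.1.2 + q.1 :=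
    (measurable_snd.comp hval).add measurable_fst
  cases i with
  | none => exact h1.compl
  | some n => exact h1.inter ((measurableSet_le (h2 n) h3).inter (measurableSet_lt h3 (h2 _)))

theorem iUnion_flowPiece : ⋃ i, flowPiece S r i = univ := by
  refine eq_univ_of_forall fun q => mem_iUnion.2 ?_
  by_cases h : IsComplete S r q.2.1.1
  · obtain ⟨n, hn⟩ := h (q.2.1.2 + q.1)
    exact ⟨some n, h, hn⟩
  · exact ⟨none, h⟩

theorem pairwise_disjoint_flowPiece (hr0 : ∀ a, 0 ≤ r a) :
    Pairwise (Function.onFun Disjoint (flowPiece S r)) := by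
  intro i j hij
  rw [Function.onFun, Set.disjoint_left]
  intro q hi hj
  cases i with
  | none =>
    cases j with
    | none => exact hij rfl
    | some n => exact hi hj.1
  | some m =>
    cases j with
    | none => exact hj hi.1
    | some n => exact hij (congrArg some (eq_of_roofSum_le_lt hr0 hi.2 hj.2))

/-- On each of the countably many measurable pieces the flow agrees with an explicit jointly
measurable map. -/
theorem measurable_uncurry_flow (hS : MeasurePreserving S volume volume) (hr : Measurable r)
    (hr0 : ∀ a, 0 ≤ r a) : Measurable (Function.uncurry (flow S r)) := by
  rintro _ ⟨B, hB, rfl⟩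
  have hval : Measurable fun q : ℝ × phaseSpace r => (q.1, (q.2 : I × ℝ)) :=
    measurable_fst.prodMk (measurable_subtype_coe.comp measurable_snd)
  have h : ∀ i, MeasurableSet
      (flowPiece S r i ∩ Function.uncurry (flow S r) ⁻¹' (Subtype.val ⁻¹' B)) := by
    intro i
    cases i with
    | none =>
      convert (measurableSet_flowPiece hS hr hr0 none).inter
        ((measurable_snd.comp hval) hB) using 1
      ext q
      refine and_congr_right fun hq => ?_
      simp only [mem_preimage, Function.uncurry, flow_of_not_isComplete hq, Function.comp]
    | some n =>
      convert (measurableSet_flowPiece hS hr hr0 (some n)).inter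
        (((measurable_shiftMap hS hr n).comp hval) hB) using 1
      ext q
      refine and_congr_right fun hq => ?_
      simp only [mem_preimage, Function.uncurry, coe_flow_eq_shiftMap hr0 hq.1 hq.2, Function.comp]
  have h2 := MeasurableSet.iUnion h
  rwa [← iUnion_inter, iUnion_flowPiece, univ_inter] at h2

/-- A skew product over `S ^ n` whose fibre maps are translations. -/
theorem measurePreserving_shiftMap (hS : MeasurePreserving S volume volume) (hr : Measurable r)
    (t : ℝ) (n : ℤ) : MeasurePreserving (shiftMap S r t n) volume volume := by
  refine MeasurePreserving.skew_product (g := fun a b => b + t - roofSum S r a n)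
    (measurePreserving_zpow hS n) ?_ (Eventually.of_forall fun a => ?_)
  · exact (measurable_snd.add_const t).sub ((measurable_roofSum hS hr n).comp measurable_fst)
  · simp_rw [add_sub_assoc]
    exact (measurePreserving_add_right volume (t - roofSum S r a n)).map_eq

theorem shiftMap_injective (t : ℝ) (n : ℤ) : Function.Injective (shiftMap S r t n) := by
  rintro ⟨a, b⟩ ⟨a', b'⟩ h
  simp only [shiftMap, Prod.mk.injEq, EmbeddingLike.apply_eq_iff_eq] at h
  obtain ⟨rfl, h⟩ := h
  exact Prod.ext rfl (by simpa using h)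

theorem measure_image_shiftMap (hS : MeasurePreserving S volume volume) (hr : Measurable r)
    (t : ℝ) (n : ℤ) (D : Set (I × ℝ)) : volume (shiftMap S r t n '' D) = volume D := by
  have hmp := measurePreserving_shiftMap hS hr t n
  rw [← hmp.measure_preimage_emb (hmp.measurable.measurableEmbedding (shiftMap_injective t n)),
    preimage_image_eq _ (shiftMap_injective t n)]

theorem measure_image_flow (hS : MeasurePreserving S volume volume) (hr : Measurable r)
    (hr0 : ∀ a, 0 ≤ r a) (t : ℝ) (i : Option ℤ) {D : Set (phaseSpace r)}
    (hD : ∀ x ∈ D, (t, x) ∈ flowPiece S r i) :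
    volume (Subtype.val '' (flow S r t '' D)) = volume (Subtype.val '' D) := by
  cases i with
  | none =>
    have : flow S r t '' D = id '' D :=
      image_congr fun x hx => flow_of_not_isComplete (hD x hx) t
    rw [this, image_id]
  | some n =>
    rw [← measure_image_shiftMap hS hr t n (Subtype.val '' D), image_image, image_image]
    congr 1
    exact image_congr fun x hx => coe_flow_eq_shiftMap hr0 (hD x hx).1 (hD x hx).2

/-- Cut the source by the number of identifications passed, and the target by the images of these
pieces, written as preimages under `flow S r (-t)`. On each piece the flow is a shift map or the
identity, so area is preserved. -/
theorem measurePreserving_flow (hS : MeasurePreserving S volume volume) (hr : Measurable r)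
    (hr0 : ∀ a, 0 ≤ r a) (t : ℝ) :
    MeasurePreserving (flow S r t) (phaseMeasure r) (phaseMeasure r) := by
  have hm : ∀ t, Measurable (flow S r t) := fun t =>
    (measurable_uncurry_flow hS hr hr0).comp measurable_prodMk_left
  have hinv : ∀ x, flow S r (-t) (flow S r t x) = x := fun x => by
    rw [← flow_add hr0, add_neg_cancel, flow_zero hr0]
  have hinv' : ∀ x, flow S r t (flow S r (-t) x) = x := fun x => by
    rw [← flow_add hr0, neg_add_cancel, flow_zero hr0]
  set ν : Measure (phaseSpace r) := (volume : Measure (I × ℝ)).comap Subtype.val with hν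
  have hνD : ∀ D, ν D = volume (Subtype.val '' D) := fun D =>
    comap_subtype_coe_apply (measurableSet_phaseSpace hr) volume D
  set P : Option ℤ → Set (phaseSpace r) := fun i => {x | (t, x) ∈ flowPiece S r i} with hP
  have hPm : ∀ i, MeasurableSet (P i) := fun i =>
    measurable_prodMk_left (measurableSet_flowPiece hS hr hr0 i)
  have hPu : ⋃ i, P i = univ := eq_univ_of_forall fun x => by
    have : (t, x) ∈ ⋃ i, flowPiece S r i := iUnion_flowPiece ▸ mem_univ _
    simpa [hP] using this
  have hPd : Pairwise (Function.onFun Disjoint P) := fun i j hij =>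
    Set.disjoint_left.2 fun x hi hj =>
      Set.disjoint_left.1 (pairwise_disjoint_flowPiece hr0 hij) hi hj
  have hsum : ∀ (Q : Option ℤ → Set (phaseSpace r)), (∀ i, MeasurableSet (Q i)) →
      ⋃ i, Q i = univ → Pairwise (Function.onFun Disjoint Q) → ∀ B, MeasurableSet B →
      ν B = ∑' i, ν (B ∩ Q i) := by
    intro Q hQm hQu hQd B hB
    rw [← measure_iUnion (fun i j hij => (hQd hij).mono inter_subset_right inter_subset_right)
      (fun i => hB.inter (hQm i)), ← inter_iUnion, hQu, inter_univ]
  have hpre : MeasurePreserving (flow S r t) ν ν := by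
    refine ⟨hm t, Measure.ext fun B hB => ?_⟩
    rw [Measure.map_apply (hm t) hB, hsum P hPm hPu hPd _ (hm t hB),
      hsum (fun i => flow S r (-t) ⁻¹' P i) (fun i => hm _ (hPm i))
        (by rw [← preimage_iUnion, hPu, preimage_univ])
        (fun i j hij => (hPd hij).preimage _) B hB]
    refine tsum_congr fun i => ?_
    rw [hνD, hνD, ← measure_image_flow hS hr hr0 t i (fun x hx => hx.2)]
    congr 2
    ext y
    constructor
    · rintro ⟨x, ⟨hxB, hxP⟩, rfl⟩
      refine ⟨hxB, ?_⟩
      rw [mem_preimage, hinv]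
      exact hxP
    · rintro ⟨hyB, hyP⟩
      refine ⟨flow S r (-t) y, ⟨?_, hyP⟩, hinv' y⟩
      rw [mem_preimage, hinv']
      exact hyB
  exact ⟨hm t, by rw [phaseMeasure, Measure.map_smul, hpre.map_eq]⟩

theorem isMeasurePreservingFlow_flow (hS : MeasurePreserving S volume volume) (hr : Measurable r)
    (hr0 : ∀ a, 0 ≤ r a) : IsMeasurePreservingFlow (flow S r) (phaseMeasure r) where
  measurable_uncurry := measurable_uncurry_flow hS hr hr0
  map_zero := flow_zero hr0
  map_add := flow_add hr0
  measurePreserving := measurePreserving_flow hS hr hr0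

theorem volume_phaseSpace (hr : Measurable r) :
    volume (phaseSpace r) = ∫⁻ a, ENNReal.ofReal (r a) := by
  rw [Measure.volume_eq_prod, Measure.prod_apply (measurableSet_phaseSpace hr)]
  refine lintegral_congr fun a => ?_
  have : Prod.mk a ⁻¹' phaseSpace r = Ico 0 (r a) := rfl
  rw [this, Real.volume_Ico, sub_zero]

theorem comap_val_univ (hr : Measurable r) :
    (volume : Measure (I × ℝ)).comap (Subtype.val : phaseSpace r → I × ℝ) univ =
      volume (phaseSpace r) := by
  rw [comap_subtype_coe_apply (measurableSet_phaseSpace hr), image_univ, Subtype.range_coe]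

/-- The normalizing factor is `0⁻¹ = ∞` here, but it multiplies the zero measure. -/
theorem phaseMeasure_eq_zero (hr : Measurable r) (h : volume (phaseSpace r) = 0) :
    phaseMeasure r = 0 := by
  have h0 : (volume : Measure (I × ℝ)).comap (Subtype.val : phaseSpace r → I × ℝ) = 0 := by
    rw [← Measure.measure_univ_eq_zero, comap_val_univ hr, h]
  rw [phaseMeasure, h0, smul_zero]

theorem isProbabilityMeasure_phaseMeasure (hr : Measurable r) (hri : Integrable r volume)
    (h : volume (phaseSpace r) ≠ 0) : IsProbabilityMeasure (phaseMeasure r) := by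
  have hfin : volume (phaseSpace r) ≠ ⊤ := by
    rw [volume_phaseSpace hr]
    exact (hri.lintegral_lt_top).ne
  refine ⟨?_⟩
  rw [phaseMeasure, Measure.smul_apply, comap_val_univ hr, smul_eq_mul,
    ENNReal.inv_mul_cancel h hfin]

end Flow

end SpecialFlow

theorem theorem2 (S : I ≃ᵐ I) (hS : MeasurePreserving S volume volume)
    (r : I → ℝ) (hr_meas : Measurable r) (hr_nonneg : ∀ a, 0 ≤ r a) (hr_int : Integrable r volume)
    (herg : SpecialFlow.IsErgodicFlow (SpecialFlow.flow S r) (SpecialFlow.phaseMeasure r))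
    (f : SpecialFlow.phaseSpace r → ℝ) (hf : Integrable f (SpecialFlow.phaseMeasure r))
    (hf_mean : ∫ x, f x ∂(SpecialFlow.phaseMeasure r) = 0)
    (A : Set (SpecialFlow.phaseSpace r))
    (hA : NullMeasurableSet A (SpecialFlow.phaseMeasure r)) :
    ∀ᵐ x ∂(SpecialFlow.phaseMeasure r), x ∈ A → f x ≠ 0 →
      ∃ t : ℕ → ℝ, Tendsto t atTop atTop ∧
        ∀ k, IntervalIntegrable (fun s => f (SpecialFlow.flow S r s x)) volume 0 (t k) ∧
          SpecialFlow.orbitIntegral (SpecialFlow.flow S r) f (t k) x = 0 ∧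
          SpecialFlow.flow S r (t k) x ∈ A := by
  -- If the region has zero area, `phaseMeasure r` is zero, not a probability measure, and the claim
  -- is vacuous.
  by_cases h : volume (SpecialFlow.phaseSpace r) = 0
  · simp [SpecialFlow.phaseMeasure_eq_zero hr_meas h]
  · have := SpecialFlow.isProbabilityMeasure_phaseMeasure hr_meas hr_int h
    have := (SpecialFlow.measurableSet_phaseSpace hr_meas).standardBorel
    exact SpecialFlow.ae_exists_zero_returns
      (SpecialFlow.isMeasurePreservingFlow_flow hS hr_meas hr_nonneg) herg hf hf_mean hA
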